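/- Consider real-rational transfer matrices, in continuous or in discrete time. Let $\Omega=\{s\in\mathbb{C}:\operatorname{Re}s>0\}$ in continuous time and $\Omega=\{z\in\mathbb{C}:|z|>1\}$ in discrete time. Let $\mathcal{R}_p$ be the set of proper transfer matrices and $\mathcal{RH}_\infty\subset\mathcal{R}_p$ the set of those without poles in the closure $\overline{\Omega}$, and let $\|\mathbf{M}\|_\infty=\sup_{s\in\Omega}\sigma_{\max}(\mathbf{M}(s))\in[0,\infty]$. A controller $\mathbf{K}$ internally stabilizes a plant $\mathbf{G}$ if $$\begin{bmatrix} I & -\mathbf{G}\\ -\mathbf{K} & I\end{bmatrix}$$ has an inverse and this inverse is in $\mathcal{RH}_\infty$. Let $\mathbf{G}\in\mathcal{R}_p$ and $\epsilon>0$, let $\mathcal{D}_\epsilon=\{\boldsymbol{\Delta}_{\mathbf G}:\|\boldsymbol{\Delta}_{\mathbf G}\|_\infty<\epsilon\}$ be the set of additive uncertainties, of the size of $\mathbf{G}$, and let $$\mathcal{K}_\epsilon=\{\mathbf{K}\in\mathcal{R}_p:\ \mathbf{K}\text{ internally stabilizes }\mathbf{G}+\boldsymbol{\Delta}_{\mathbf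 G}\text{ for all }\boldsymbol{\Delta}_{\mathbf G}\in\mathcal{D}_\epsilon\}.$$ Then $\mathcal{K}_\epsilon$ is parameterized by input-output parameters: it is exactly the set of all proper controllers $\hat{\mathbf K}=\hat{\mathbf U}\hat{\mathbf Y}^{-1}$ where $\hat{\mathbf Y},\hat{\mathbf W},\hat{\mathbf U},\hat{\mathbf Z}$ satisfy $$\begin{bmatrix} I & -\mathbf{G}\end{bmatrix}\begin{bmatrix}\hat{\mathbf Y}&\hat{\mathbf W}\\ \hat{\mathbf U}&\hat{\mathbf Z}\end{bmatrix}=\begin{bmatrix} I & O\end{bmatrix},\qquad \begin{bmatrix}\hat{\mathbf Y}&\hat{\mathbf W}\\ \hat{\mathbf U}&\hat{\mathbf Z}\end{bmatrix}\begin{bmatrix}-\mathbf{G}\\ I\end{bmatrix}=\begin{bmatrix}O\\ I\end{bmatrix},\qquad \hat{\mathbf Y},\hat{\mathbf W},\hat{\mathbf U},\hat{\mathbf Z}\in\mathcal{RH}_\infty,$$ $$\|\hat{\mathbf U}\|_\infty\le\epsilon^{-1},$$ and $\hat{\mathbf Y}$ is invertible as a matrix of rational functions. If $\mathbf{G}$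 is strictly proper, then for all parameters that satisfy the displayed input-output constraints, $\hat{\mathbf Y}$ is invertible and $\hat{\mathbf U}\hat{\mathbf Y}^{-1}$ is proper, so that every choice of parameters satisfying the constraints and the norm bound gives a controller in $\mathcal{K}_\epsilon$. -/

import Mathlib

/-- The two settings for linear time-invariant systems. -/
inductive TimeSetting where
  | continuous
  | discrete

/-- The open region on which stable transfer functions are analytic and over which the
`H∞` norm is taken: `Re s > 0` in continuous time, `|z| > 1` in discrete time. -/
def TimeSetting.openRegion : TimeSetting → Set ℂ
  | .continuous => {s | 0 < s.re}
  | .discrete => {z | 1 < ‖z‖}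

/-- The closed region in which a stable transfer function has no pole: `Re s ≥ 0` in continuous
time, `|z| ≥ 1` in discrete time (the point at infinity is dealt with by properness). -/
def TimeSetting.closedRegion : TimeSetting → Set ℂ
  | .continuous => {s | 0 ≤ s.re}
  | .discrete => {z | 1 ≤ ‖z‖}

/-- Real-rational transfer matrices with `p` rows and `m` columns. -/
abbrev TransferMatrix (p m : Type*) : Type _ := Matrix p m (RatFunc ℝ)

namespace TransferMatrix

/-- Proper transfer matrices: in every entry the degree of the numerator is at most the degree of
the denominator. -/
def IsProper {p m : Type*} (M : TransferMatrix p m) : Prop :=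
  ∀ i j, (M i j).num.degree ≤ (M i j).denom.degree

/-- Strictly proper transfer matrices. -/
def IsStrictlyProper {p m : Type*} (M : TransferMatrix p m) : Prop :=
  ∀ i j, (M i j).num.degree < (M i j).denom.degree

/-- Membership in `RH∞`: proper, and no entry has a pole in the closed unstable region
(`num` and `denom` of a `RatFunc` are coprime, so the poles are the roots of `denom`). -/
def IsRHInf {p m : Type*} (T : TimeSetting) (M : TransferMatrix p m) : Prop :=
  M.IsProper ∧ ∀ i j, ∀ s ∈ T.closedRegion, Polynomial.aeval s (M i j).denom ≠ 0

/-- The value of a transfer matrix at a complex number. -/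
noncomputable def evalAt {p m : Type*} (M : TransferMatrix p m) (s : ℂ) : Matrix p m ℂ :=
  Matrix.of fun i j => (M i j).eval (algebraMap ℝ ℂ) s

open scoped Matrix.Norms.L2Operator in
/-- The `H∞` norm: the supremum over the open region of the largest singular value (the operator
norm between Euclidean spaces), as an extended nonnegative real. It is `∞` for a matrix with a pole
in the closed region or at infinity, since the values are then unbounded on the open region. -/
noncomputable def hInfNorm {p m : Type*} [Fintype p] [Fintype m] [DecidableEq m]
    (T : TimeSetting) (M : TransferMatrix p m) : ENNReal :=
  ⨆ s ∈ T.openRegion, ‖M.evalAt s‖ₑ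

/-- The realization matrix `R` of the feedback loop of a plant `G` and a controller `K`:
with internal state `η = (y, u)` and disturbance `d`, `η = R η + d` means
`y = G u + d₁` and `u = K y + d₂`. -/
noncomputable def realization {p m : Type*} (G : TransferMatrix p m) (K : TransferMatrix m p) :
    TransferMatrix (p ⊕ m) (p ⊕ m) :=
  Matrix.fromBlocks 0 G K 0

/-- `K` internally stabilizes `G`: the stability matrix `S`, the map `d ↦ η` of the loop,
i.e. the inverse of `I - R`, exists and belongs to `RH∞`. -/
def InternallyStabilizes {p m : Type*} [Fintype p] [Fintype m] [DecidableEq p] [DecidableEq m]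
    (T : TimeSetting) (K : TransferMatrix m p) (G : TransferMatrix p m) : Prop :=
  ∃ S : TransferMatrix (p ⊕ m) (p ⊕ m),
    (1 - realization G K) * S = 1 ∧ S * (1 - realization G K) = 1 ∧ S.IsRHInf T

/-- The set `D_ε` of plant uncertainties of `H∞` norm less than `ε`. -/
def uncertaintySet {p m : Type*} [Fintype p] [Fintype m] [DecidableEq m]
    (T : TimeSetting) (ε : ℝ) : Set (TransferMatrix p m) :=
  {Δ | Δ.hInfNorm T < ENNReal.ofReal ε}

/-- The set `K_ε` of robustly stabilizing controllers: the proper controllers that internally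
stabilize `G + Δ` for every `Δ` in `D_ε`. -/
def robustControllers {p m : Type*} [Fintype p] [Fintype m] [DecidableEq p] [DecidableEq m]
    (T : TimeSetting) (ε : ℝ) (G : TransferMatrix p m) : Set (TransferMatrix m p) :=
  {K | K.IsProper ∧
    ∀ Δ ∈ (uncertaintySet T ε : Set (TransferMatrix p m)), InternallyStabilizes T K (G + Δ)}

/-- The constraints of the input-output parameterization:
`[I, -G] [Y, W; U, Z] = [I, O]`, `[Y, W; U, Z] [-G; I] = [O; I]`, and `Y, W, U, Z ∈ RH∞`. -/
def IOPConstraints {p m : Type*} [Fintype p] [Fintype m] [DecidableEq p] [DecidableEq m]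
    (T : TimeSetting) (G : TransferMatrix p m) (Y : TransferMatrix p p) (W : TransferMatrix p m)
    (U : TransferMatrix m p) (Z : TransferMatrix m m) : Prop :=
  Matrix.fromCols (1 : TransferMatrix p p) (-G) * Matrix.fromBlocks Y W U Z =
      Matrix.fromCols (1 : TransferMatrix p p) (0 : TransferMatrix p m) ∧
    Matrix.fromBlocks Y W U Z * Matrix.fromRows (-G) (1 : TransferMatrix m m) =
      Matrix.fromRows (0 : TransferMatrix p m) (1 : TransferMatrix m m) ∧
    Y.IsRHInf T ∧ W.IsRHInf T ∧ U.IsRHInf T ∧ Z.IsRHInf T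

end TransferMatrix

/-!
The parameters `Y, W, U, Z` of a controller `K` are the blocks of the stability matrix of the loop
with the nominal plant `G`. For the loop with the plant `G + Δ` the block `U` is replaced by
`U (1 - Δ U)⁻¹`, so that the theorem is a small-gain theorem for `U` and real-rational `Δ`.

*Sufficiency.* The stability matrix of the perturbed loop is a polynomial expression in `Δ`, the
nominal parameters and `E = (1 - U Δ)⁻¹` (`IOPConstraints.internallyStabilizes_add`). A transfer
matrix that is bounded on the open region, up to finitely many points, belongs to `RH∞`
(`isRHInf_of_bounded`). This applies to every `Δ` of norm less than `ε`, which is not assumed to be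
stable, and also to `E`, whose values `X` satisfy `X = 1 + U Δ X` and are bounded since
`‖U Δ‖∞ < 1` (`IsRHInf.one_sub_inv`).

*Necessity.* In a coordinate `q` of the closed unit disc, stable rational functions become
holomorphic on the closed disc, the point at infinity included. By the maximum modulus principle
and continuity, a matrix `U` with `‖U‖∞ > ε⁻¹` has norm greater than `ε⁻¹` at some boundary point
`s₀` that is neither real nor infinite (`IsRHInf.hInfNorm_le_of_forall_circle`). There is then a
complex matrix of rank one and norm less than `ε` that maps `U(s₀) x` to `x`, for some `x ≠ 0`. It
is the value at `s₀` of a real-rational stable `Δ` of the same norm, since the constants `±1` and,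
up to sign, the functions `(q - a) / (1 - a q)` with real `a` take every unimodular value at a
unimodular `q` that is not real (`exists_stable_evalAt_eq_vecMulVec`). As `1 - Δ U` annihilates `x`
at `s₀` and `U` does not, `U (1 - Δ U)⁻¹` has a pole at `s₀`
(`hInfNorm_le_of_internallyStabilizes`).

*Strictly proper plants.* The matrix `Y = 1 + G U` is the identity at infinity, hence invertible
over the ring of proper rational functions (`IOPConstraints.isUnit_det_and_isProper`).
-/

/-! ### Rings of rational functions -/

open Polynomial in
/-- The rational functions without a pole at the complex number `s`. -/
def RatFunc.regularAt (s : ℂ) : Subring (RatFunc ℝ) where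
  carrier := {f | aeval s f.denom ≠ 0}
  zero_mem' := by simp
  one_mem' := by simp
  mul_mem' {f g} hf hg h := by
    have := aeval_eq_zero_of_dvd_aeval_eq_zero (RatFunc.denom_mul_dvd f g) h
    rw [map_mul] at this
    exact mul_ne_zero hf hg this
  add_mem' {f g} hf hg h := by
    have := aeval_eq_zero_of_dvd_aeval_eq_zero (RatFunc.denom_add_dvd f g) h
    rw [map_mul] at this
    exact mul_ne_zero hf hg this
  neg_mem' {f} hf h := by
    have hd : (-f).denom ∣ f.denom := by
      rw [RatFunc.denom_dvd f.denom_ne_zero]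
      exact ⟨-f.num, by rw [map_neg, neg_div, RatFunc.num_div_denom]⟩
    exact hf (aeval_eq_zero_of_dvd_aeval_eq_zero hd h)

theorem RatFunc.mem_regularAt {s : ℂ} {f : RatFunc ℝ} :
    f ∈ RatFunc.regularAt s ↔ Polynomial.aeval s f.denom ≠ 0 := Iff.rfl

/-- Evaluation at `s`, as a ring homomorphism on the rational functions without a pole at `s`. -/
noncomputable def RatFunc.evalRegular (s : ℂ) : RatFunc.regularAt s →+* ℂ where
  toFun f := (f : RatFunc ℝ).eval (algebraMap ℝ ℂ) s
  map_one' := RatFunc.eval_one _ _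
  map_zero' := RatFunc.eval_zero _ _
  map_mul' f g := RatFunc.eval_mul _ _ f.2 g.2
  map_add' f g := RatFunc.eval_add _ _ f.2 g.2

open Polynomial in
theorem RatFunc.eval_div_of_ne_zero {s : ℂ} (n d : ℝ[X]) (hd : aeval s d ≠ 0) :
    (algebraMap ℝ[X] (RatFunc ℝ) n / algebraMap ℝ[X] (RatFunc ℝ) d).eval (algebraMap ℝ ℂ) s =
      aeval s n / aeval s d := by
  have hd0 : d ≠ 0 := by rintro rfl; simp at hd
  set f := algebraMap ℝ[X] (RatFunc ℝ) n / algebraMap ℝ[X] (RatFunc ℝ) d with hf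
  have hdvd : f.denom ∣ d := RatFunc.denom_div_dvd n d
  have hden : aeval s f.denom ≠ 0 := fun h => hd (aeval_eq_zero_of_dvd_aeval_eq_zero hdvd h)
  have key : f.num * d = n * f.denom := (RatFunc.num_mul_eq_mul_denom_iff hd0).2 hf
  have := congrArg (aeval s) key
  rw [map_mul, map_mul] at this
  change aeval s f.num / aeval s f.denom = _
  rw [div_eq_div_iff hden hd, this]

open Classical in
/-- The proper rational functions: the valuation ring of the place at infinity. -/
noncomputable def RatFunc.properRing : ValuationSubring (RatFunc ℝ) :=
  (RatFunc.inftyValuation ℝ).valuationSubring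

theorem RatFunc.mem_properRing {f : RatFunc ℝ} :
    f ∈ RatFunc.properRing ↔ f.num.degree ≤ f.denom.degree := by
  classical
  rw [RatFunc.properRing, Valuation.mem_valuationSubring_iff, RatFunc.inftyValuation_apply]
  by_cases hf : f = 0
  · simp [hf, RatFunc.InftyValuation.map_zero']
  · rw [RatFunc.inftyValuation_of_nonzero ℝ hf, ← WithZero.exp_zero, WithZero.exp_le_exp,
      RatFunc.intDegree, Polynomial.degree_eq_natDegree (RatFunc.num_ne_zero hf),
      Polynomial.degree_eq_natDegree f.denom_ne_zero, Nat.cast_le]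
    omega

/-- Strictly proper rational functions lie in the maximal ideal of the ring of proper ones: their
inverses have positive degree. -/
theorem RatFunc.residue_eq_zero_of_degree_lt {f : RatFunc ℝ} (hf : f ∈ RatFunc.properRing)
    (h : f.num.degree < f.denom.degree) :
    IsLocalRing.residue RatFunc.properRing ⟨f, hf⟩ = 0 := by
  classical
  rw [IsLocalRing.residue_eq_zero_iff, IsLocalRing.mem_maximalIdeal, mem_nonunits_iff]
  intro hu
  obtain ⟨g, hg⟩ := hu.exists_right_inv
  have hfg : f * g = 1 := congrArg Subtype.val hg
  have hf0 : f ≠ 0 := left_ne_zero_of_mul_eq_one hfg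
  have hg0 : (g : RatFunc ℝ) ≠ 0 := right_ne_zero_of_mul_eq_one hfg
  have h1 := RatFunc.intDegree_mul hf0 hg0
  rw [hfg, RatFunc.intDegree_one] at h1
  have h2 := RatFunc.mem_properRing.1 g.2
  simp only [RatFunc.intDegree] at h1
  rw [Polynomial.degree_eq_natDegree (RatFunc.num_ne_zero hf0),
      Polynomial.degree_eq_natDegree f.denom_ne_zero] at h
  rw [Polynomial.degree_eq_natDegree (RatFunc.num_ne_zero hg0),
      Polynomial.degree_eq_natDegree (RatFunc.denom_ne_zero _)] at h2
  norm_cast at h h2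
  omega

/-- The scalar `RH∞`: proper rational functions without poles in the closed unstable region. -/
noncomputable def RatFunc.stableRing (T : TimeSetting) : Subring (RatFunc ℝ) :=
  RatFunc.properRing.toSubring ⊓ ⨅ s ∈ T.closedRegion, RatFunc.regularAt s

theorem RatFunc.mem_stableRing {T : TimeSetting} {f : RatFunc ℝ} :
    f ∈ RatFunc.stableRing T ↔
      f ∈ RatFunc.properRing ∧ ∀ s ∈ T.closedRegion, f ∈ RatFunc.regularAt s := by
  simp [RatFunc.stableRing, Subring.mem_iInf]

/-! ### Transfer matrices over these rings -/

theorem Matrix.mul_apply_mem {R p m n : Type*} [Ring R] [Fintype m] (S : Subring R)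
    {A : Matrix p m R} {B : Matrix m n R} (hA : ∀ i j, A i j ∈ S) (hB : ∀ i j, B i j ∈ S) (i j) :
    (A * B) i j ∈ S :=
  S.sum_mem fun k _ => S.mul_mem (hA i k) (hB k j)

theorem Matrix.one_apply_mem {R p : Type*} [Ring R] [DecidableEq p] (S : Subring R) (i j : p) :
    (1 : Matrix p p R) i j ∈ S := by
  rw [Matrix.one_apply]; split_ifs
  exacts [S.one_mem, S.zero_mem]

namespace TransferMatrix

theorem isProper_iff {p m : Type*} {M : TransferMatrix p m} :
    M.IsProper ↔ ∀ i j, M i j ∈ RatFunc.properRing := by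
  simp only [IsProper, RatFunc.mem_properRing]

theorem isRHInf_iff {p m : Type*} {T : TimeSetting} {M : TransferMatrix p m} :
    M.IsRHInf T ↔ ∀ i j, M i j ∈ RatFunc.stableRing T := by
  simp only [IsRHInf, isProper_iff, RatFunc.mem_stableRing, RatFunc.mem_regularAt]
  exact ⟨fun h i j => ⟨h.1 i j, h.2 i j⟩, fun h => ⟨fun i j => (h i j).1, fun i j => (h i j).2⟩⟩

theorem IsRHInf.mem_regularAt {p m : Type*} {T : TimeSetting} {M : TransferMatrix p m}
    (h : M.IsRHInf T) {s : ℂ} (hs : s ∈ T.closedRegion) (i : p) (j : m) :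
    M i j ∈ RatFunc.regularAt s :=
  h.2 i j s hs

theorem evalAt_mul {p m n : Type*} [Fintype m] {s : ℂ} {A : TransferMatrix p m}
    {B : TransferMatrix m n} (hA : ∀ i j, A i j ∈ RatFunc.regularAt s)
    (hB : ∀ i j, B i j ∈ RatFunc.regularAt s) :
    evalAt (A * B) s = A.evalAt s * B.evalAt s := by
  ext i j
  have h : (A * B) i j =
      ((∑ k, (⟨A i k, hA i k⟩ * ⟨B k j, hB k j⟩ : RatFunc.regularAt s) :
        RatFunc.regularAt s) : RatFunc ℝ) := by
    simp [Matrix.mul_apply]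
  change ((A * B) i j).eval (algebraMap ℝ ℂ) s = _
  rw [h]
  change RatFunc.evalRegular s _ = _
  rw [map_sum, Matrix.mul_apply]
  exact Finset.sum_congr rfl fun k _ => map_mul _ _ _

theorem evalAt_sub {p m : Type*} {s : ℂ} {A B : TransferMatrix p m}
    (hA : ∀ i j, A i j ∈ RatFunc.regularAt s) (hB : ∀ i j, B i j ∈ RatFunc.regularAt s) :
    evalAt (A - B) s = A.evalAt s - B.evalAt s := by
  ext i j
  exact map_sub (RatFunc.evalRegular s) ⟨A i j, hA i j⟩ ⟨B i j, hB i j⟩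

theorem evalAt_one {p : Type*} [DecidableEq p] (s : ℂ) :
    evalAt (1 : TransferMatrix p p) s = 1 := by
  ext i j
  change ((1 : TransferMatrix p p) i j).eval (algebraMap ℝ ℂ) s = _
  rw [Matrix.one_apply, Matrix.one_apply]
  split_ifs <;> simp

theorem evalAt_det {p : Type*} [Fintype p] [DecidableEq p] {s : ℂ} {A : TransferMatrix p p}
    (hA : ∀ i j, A i j ∈ RatFunc.regularAt s) :
    A.det.eval (algebraMap ℝ ℂ) s = (A.evalAt s).det := by
  set N : Matrix p p (RatFunc.regularAt s) := Matrix.of fun i j => ⟨A i j, hA i j⟩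
  have h1 : A = (RatFunc.regularAt s).subtype.mapMatrix N := rfl
  have h2 : A.evalAt s = (RatFunc.evalRegular s).mapMatrix N := rfl
  rw [h2, ← RingHom.map_det, h1, ← RingHom.map_det]
  rfl

end TransferMatrix

/-! ### The operator norm of complex matrices -/

section OperatorNorm

open scoped Matrix Matrix.Norms.L2Operator

variable {p m : Type*} [Fintype p] [Fintype m] [DecidableEq m]

theorem Matrix.l2_opNorm_le_of_forall {A : Matrix p m ℂ} {C : ℝ} (hC : 0 ≤ C)
    (h : ∀ x : EuclideanSpace ℂ m, ‖WithLp.toLp 2 (A *ᵥ x.ofLp)‖ ≤ C * ‖x‖) : ‖A‖ ≤ C := by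
  rw [Matrix.l2_opNorm_def]
  exact ContinuousLinearMap.opNorm_le_bound _ hC h

theorem Matrix.norm_apply_le_l2_opNorm (A : Matrix p m ℂ) (i : p) (j : m) : ‖A i j‖ ≤ ‖A‖ := by
  have h := A.l2_opNorm_mulVec (EuclideanSpace.single j 1)
  rw [PiLp.norm_single, norm_one, mul_one] at h
  refine le_trans ?_ h
  refine le_trans ?_ (PiLp.norm_apply_le _ i)
  simp

theorem Matrix.l2_opNorm_vecMulVec_le (x : EuclideanSpace ℂ p) (y : EuclideanSpace ℂ m) :
    ‖Matrix.vecMulVec x.ofLp y.ofLp‖ ≤ ‖x‖ * ‖y‖ := by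
  refine Matrix.l2_opNorm_le_of_forall (by positivity) fun z => ?_
  have h1 : Matrix.vecMulVec x.ofLp y.ofLp *ᵥ z.ofLp = (y.ofLp ⬝ᵥ z.ofLp) • x.ofLp := by
    ext i
    simp [Matrix.mulVec, Matrix.vecMulVec_apply, dotProduct, Finset.mul_sum, mul_assoc, mul_comm]
  have h2 : y.ofLp ⬝ᵥ z.ofLp = inner ℂ (WithLp.toLp 2 (star y.ofLp)) z := by
    rw [EuclideanSpace.inner_eq_star_dotProduct]
    simp [dotProduct_comm]
  have h3 : ‖(WithLp.toLp 2 (star y.ofLp) : EuclideanSpace ℂ m)‖ = ‖y‖ := by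
    simp [EuclideanSpace.norm_eq]
  rw [h1, WithLp.toLp_smul, norm_smul, h2]
  calc _ ≤ (‖y‖ * ‖z‖) * ‖x‖ := by
        gcongr
        exact (norm_inner_le_norm _ _).trans_eq (by rw [h3])
    _ = _ := by ring

theorem Matrix.isUnit_one_sub_of_l2_opNorm_lt_one [DecidableEq p] {A : Matrix p p ℂ} (h : ‖A‖ < 1) :
    IsUnit (1 - A) := isUnit_one_sub_of_norm_lt_one h

end OperatorNorm

/-! ### Bounded transfer matrices are stable -/

theorem TimeSetting.isOpen_openRegion (T : TimeSetting) : IsOpen T.openRegion := by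
  cases T
  · exact isOpen_lt continuous_const Complex.continuous_re
  · exact isOpen_lt continuous_const continuous_norm

theorem TimeSetting.closedRegion_subset_closure (T : TimeSetting) :
    T.closedRegion ⊆ closure T.openRegion := by
  cases T
  · exact (Complex.closure_setOfPred_lt_re 0).ge
  · have h : TimeSetting.discrete.openRegion = (Metric.closedBall (0 : ℂ) 1)ᶜ := by
      ext z; simp [TimeSetting.openRegion]
    rw [h, closure_compl, interior_closedBall _ one_ne_zero]
    intro z hz
    simpa [TimeSetting.closedRegion] using hz

theorem TimeSetting.openRegion_subset_closedRegion (T : TimeSetting) :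
    T.openRegion ⊆ T.closedRegion := by
  cases T
  · exact fun s (hs : 0 < s.re) => hs.le
  · exact fun s (hs : 1 < ‖s‖) => hs.le

theorem TimeSetting.ofReal_mem_openRegion (T : TimeSetting) {x : ℝ} (hx : 1 < x) :
    (x : ℂ) ∈ T.openRegion := by
  cases T
  · change 0 < (x : ℂ).re
    rw [Complex.ofReal_re]; linarith
  · change 1 < ‖(x : ℂ)‖
    rw [Complex.norm_real]; exact hx.trans_le (le_abs_self x)

open Polynomial Filter in
/-- A rational function that is bounded on the open region, up to finitely many points, has no pole
in the closed region, by coprimality of numerator and denominator, and is proper, since its values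
at large real numbers are bounded. -/
theorem RatFunc.mem_stableRing_of_bounded {T : TimeSetting} {f : RatFunc ℝ} {C : ℝ} {B : Set ℂ}
    (hB : B.Finite)
    (h : ∀ s ∈ T.openRegion, s ∉ B → ‖f.eval (algebraMap ℝ ℂ) s‖ ≤ C) :
    f ∈ RatFunc.stableRing T := by
  have hroots : {s : ℂ | aeval s f.denom = 0}.Finite := by
    refine (f.denom.rootSet_finite ℂ).subset fun s hs => ?_
    rw [mem_rootSet]
    exact ⟨f.denom_ne_zero, hs⟩
  set B' : Set ℂ := B ∪ {s : ℂ | aeval s f.denom = 0} with hB'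
  have hfin : B'.Finite := hB.union hroots
  have hbd : ∀ s ∈ T.openRegion ∩ B'ᶜ, ‖aeval s f.num‖ ≤ C * ‖aeval s f.denom‖ := by
    rintro s ⟨hs, hsB⟩
    have h1 : s ∉ B := fun h' => hsB (Or.inl h')
    have h2 : aeval s f.denom ≠ 0 := fun h' => hsB (Or.inr h')
    have h3 := h s hs h1
    change ‖aeval s f.num / aeval s f.denom‖ ≤ C at h3
    rwa [norm_div, div_le_iff₀ (norm_pos_iff.2 h2)] at h3
  refine RatFunc.mem_stableRing.2 ⟨?_, ?_⟩
  · rw [RatFunc.mem_properRing]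
    by_contra! hdeg
    have ht := abs_div_tendsto_atTop_atTop_of_degree_gt _ _ hdeg f.denom_ne_zero
    have hre : (Complex.ofReal ⁻¹' B').Finite := hfin.preimage Complex.ofReal_injective.injOn
    have h1 : ∀ᶠ x : ℝ in atTop, x ∉ Complex.ofReal ⁻¹' B' := by
      obtain ⟨b, hb⟩ := hre.bddAbove
      filter_upwards [eventually_gt_atTop b] with x hx hxm using absurd (hb hxm) (not_le.2 hx)
    obtain ⟨x, hx1, hx2, hx3⟩ :=
      ((h1.and ((eventually_gt_atTop 1).and (ht.eventually_gt_atTop C)))).exists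
    have h2 := hbd x ⟨T.ofReal_mem_openRegion hx2, hx1⟩
    rw [← Complex.coe_algebraMap, aeval_algebraMap_apply, aeval_algebraMap_apply,
      Complex.coe_algebraMap, Complex.norm_real, Complex.norm_real] at h2
    have hx4 : f.denom.eval x ≠ 0 := by
      intro h0
      apply hx1
      right
      change aeval (x : ℂ) f.denom = 0
      rw [← Complex.coe_algebraMap, aeval_algebraMap_apply, coe_aeval_eq_eval, h0, map_zero]
    rw [abs_div, lt_div_iff₀ (abs_pos.2 hx4)] at hx3
    exact absurd h2 (not_le.2 hx3)
  · intro s hs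
    rw [RatFunc.mem_regularAt]
    intro h0
    have hcl : s ∈ closure (T.openRegion ∩ B'ᶜ) :=
      closure_minimal
        ((hfin.countable.dense_compl ℝ).open_subset_closure_inter T.isOpen_openRegion)
        isClosed_closure (T.closedRegion_subset_closure hs)
    have hclosed : IsClosed {s : ℂ | ‖aeval s f.num‖ ≤ C * ‖aeval s f.denom‖} :=
      isClosed_le (by fun_prop) (by fun_prop)
    have h1 : ‖aeval s f.num‖ ≤ C * ‖aeval s f.denom‖ := closure_minimal hbd hclosed hcl
    rw [h0, norm_zero, mul_zero, norm_le_zero_iff] at h1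
    obtain ⟨a, b, hab⟩ := f.isCoprime_num_denom
    have := congrArg (aeval s) hab
    simp [h0, h1] at this

namespace TransferMatrix

open scoped Matrix Matrix.Norms.L2Operator

variable {p m : Type*} [Fintype p] [Fintype m] [DecidableEq m]

theorem hInfNorm_le_ofReal_iff {T : TimeSetting} {M : TransferMatrix p m} {C : ℝ} (hC : 0 ≤ C) :
    M.hInfNorm T ≤ ENNReal.ofReal C ↔ ∀ s ∈ T.openRegion, ‖M.evalAt s‖ ≤ C := by
  simp only [hInfNorm, iSup_le_iff]
  refine forall₂_congr fun s _ => ?_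
  rw [← ofReal_norm, ENNReal.ofReal_le_ofReal_iff hC]

theorem isRHInf_of_bounded {T : TimeSetting} {M : TransferMatrix p m} {C : ℝ} {B : Set ℂ}
    (hB : B.Finite) (h : ∀ s ∈ T.openRegion, s ∉ B → ‖M.evalAt s‖ ≤ C) : M.IsRHInf T :=
  isRHInf_iff.2 fun i j => RatFunc.mem_stableRing_of_bounded hB fun s hs hsB =>
    ((M.evalAt s).norm_apply_le_l2_opNorm i j).trans (h s hs hsB)

theorem exists_bound_of_hInfNorm_lt {T : TimeSetting} {M : TransferMatrix p m} {ε : ℝ}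
    (h : M.hInfNorm T < ENNReal.ofReal ε) :
    ∃ δ, 0 ≤ δ ∧ δ < ε ∧ ∀ s ∈ T.openRegion, ‖M.evalAt s‖ ≤ δ := by
  have hne : M.hInfNorm T ≠ ⊤ := h.ne_top
  refine ⟨(M.hInfNorm T).toReal, ENNReal.toReal_nonneg, ?_, ?_⟩
  · exact (ENNReal.lt_ofReal_iff_toReal_lt hne).1 h
  · rw [← hInfNorm_le_ofReal_iff ENNReal.toReal_nonneg, ENNReal.ofReal_toReal hne]

theorem exists_finite_forall_mem_regularAt {p m : Type*} [Finite p] [Finite m]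
    (M : TransferMatrix p m) :
    ∃ B : Set ℂ, B.Finite ∧ ∀ s ∉ B, ∀ i j, M i j ∈ RatFunc.regularAt s := by
  refine ⟨⋃ i, ⋃ j, (M i j).denom.rootSet ℂ, ?_, fun s hs i j h0 => hs ?_⟩
  · exact Set.finite_iUnion fun i => Set.finite_iUnion fun j => Polynomial.rootSet_finite _ _
  · simp only [Set.mem_iUnion]
    exact ⟨i, j, Polynomial.mem_rootSet.2 ⟨(M i j).denom_ne_zero, h0⟩⟩

end TransferMatrix

/-! ### The feedback loop in terms of its stability matrix -/

namespace TransferMatrix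

open scoped Matrix.Norms.L2Operator

variable {p m : Type*} [Fintype p] [Fintype m] [DecidableEq p] [DecidableEq m] {T : TimeSetting}

theorem one_sub_realization {p m : Type*} [DecidableEq p] [DecidableEq m]
    (G : TransferMatrix p m) (K : TransferMatrix m p) :
    1 - realization G K = Matrix.fromBlocks 1 (-G) (-K) 1 := by
  rw [realization, ← Matrix.fromBlocks_one, sub_eq_add_neg, Matrix.fromBlocks_neg,
    Matrix.fromBlocks_add]
  simp

theorem iopConstraints_iff {G : TransferMatrix p m} {Y : TransferMatrix p p}
    {W : TransferMatrix p m} {U : TransferMatrix m p} {Z : TransferMatrix m m} :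
    IOPConstraints T G Y W U Z ↔
      (Y - G * U = 1 ∧ W - G * Z = 0 ∧ W - Y * G = 0 ∧ Z - U * G = 1) ∧
        Y.IsRHInf T ∧ W.IsRHInf T ∧ U.IsRHInf T ∧ Z.IsRHInf T := by
  rw [IOPConstraints, Matrix.fromCols_mul_fromBlocks, Matrix.fromBlocks_mul_fromRows,
    Matrix.fromCols_inj.eq_iff, Matrix.fromRows_inj.eq_iff]
  simp only [Matrix.one_mul, Matrix.mul_one, Matrix.neg_mul, Matrix.mul_neg,
    sub_eq_add_neg, and_assoc]
  rw [add_comm W (-(Y * G)), add_comm Z (-(U * G))]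

theorem isRHInf_fromBlocks_iff {p m : Type*} {A : TransferMatrix p p} {B : TransferMatrix p m}
    {C : TransferMatrix m p} {D : TransferMatrix m m} :
    IsRHInf T (Matrix.fromBlocks A B C D : TransferMatrix (p ⊕ m) (p ⊕ m)) ↔
      A.IsRHInf T ∧ B.IsRHInf T ∧ C.IsRHInf T ∧ D.IsRHInf T := by
  simp only [isRHInf_iff, Sum.forall, Matrix.fromBlocks_apply₁₁, Matrix.fromBlocks_apply₁₂,
    Matrix.fromBlocks_apply₂₁, Matrix.fromBlocks_apply₂₂, forall_and]
  tauto

theorem IsRHInf.mul {p m n : Type*} [Fintype m] {A : TransferMatrix p m} {B : TransferMatrix m n}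
    (hA : A.IsRHInf T) (hB : B.IsRHInf T) : IsRHInf T (A * B) :=
  isRHInf_iff.2 (Matrix.mul_apply_mem _ (isRHInf_iff.1 hA) (isRHInf_iff.1 hB))

theorem IsRHInf.add {p m : Type*} {A B : TransferMatrix p m}
    (hA : A.IsRHInf T) (hB : B.IsRHInf T) : IsRHInf T (A + B) :=
  isRHInf_iff.2 fun i j => add_mem (isRHInf_iff.1 hA i j) (isRHInf_iff.1 hB i j)

/-- The parameters of the loop are the blocks of the stability matrix. -/
theorem InternallyStabilizes.exists_parameters {G : TransferMatrix p m} {K : TransferMatrix m p}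
    (h : InternallyStabilizes T K G) :
    ∃ (Y : TransferMatrix p p) (W : TransferMatrix p m) (U : TransferMatrix m p)
      (Z : TransferMatrix m m), IOPConstraints T G Y W U Z ∧ U = K * Y ∧
        (1 - G * K) * Y = 1 := by
  obtain ⟨S, h1, h2, hS⟩ := h
  refine ⟨S.toBlocks₁₁, S.toBlocks₁₂, S.toBlocks₂₁, S.toBlocks₂₂, ?_⟩
  rw [← S.fromBlocks_toBlocks, one_sub_realization, Matrix.fromBlocks_multiply,
    ← Matrix.fromBlocks_one, Matrix.fromBlocks_inj] at h1 h2
  rw [← S.fromBlocks_toBlocks, isRHInf_fromBlocks_iff] at hS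
  simp only [Matrix.one_mul, Matrix.mul_one, Matrix.neg_mul, Matrix.mul_neg] at h1 h2
  obtain ⟨h11, h12, h13, h14⟩ := h1
  obtain ⟨h21, h22, h23, h24⟩ := h2
  have hU : S.toBlocks₂₁ = K * S.toBlocks₁₁ := by rw [← sub_eq_zero, ← h13]; abel
  refine ⟨iopConstraints_iff.2 ⟨⟨?_, ?_, ?_, ?_⟩, hS⟩, hU, ?_⟩
  · rw [← h11]; abel
  · rw [← h12]; abel
  · rw [← h22]; abel
  · rw [← h24]; abel
  · rw [Matrix.sub_mul, Matrix.one_mul, Matrix.mul_assoc, ← hU, ← h11]; abel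

/-- If the parameters of the loop with the plant `G` are stable and `1 - U Δ` has a stable inverse
`E`, then the loop with the plant `G + Δ` is internally stable: its stability matrix has the blocks
`Y + Y Δ E U`, `W + Y Δ E Z`, `E U` and `E Z`. -/
theorem IOPConstraints.internallyStabilizes_add {G : TransferMatrix p m} {Y : TransferMatrix p p}
    {W : TransferMatrix p m} {U : TransferMatrix m p} {Z : TransferMatrix m m}
    (h : IOPConstraints T G Y W U Z) (hY : IsUnit Y.det) {Δ : TransferMatrix p m}
    (hΔ : Δ.IsRHInf T) {E : TransferMatrix m m} (hE : E.IsRHInf T) (hE1 : E * (1 - U * Δ) = 1) :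
    InternallyStabilizes T (U * Y⁻¹) (G + Δ) := by
  obtain ⟨⟨e1, -, e3, e4⟩, hYs, hWs, hUs, hZs⟩ := iopConstraints_iff.1 h
  have hYi : Y * Y⁻¹ = 1 := Matrix.mul_nonsing_inv Y hY
  have hZK : Z * (U * Y⁻¹) = U := by
    have h1 : Z * U = U * Y := by
      rw [sub_eq_iff_eq_add.1 e4, sub_eq_iff_eq_add.1 e1, Matrix.add_mul, Matrix.mul_add,
        Matrix.one_mul, Matrix.mul_one, Matrix.mul_assoc]
    rw [← Matrix.mul_assoc, h1, Matrix.mul_assoc, hYi, Matrix.mul_one]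
  have hWK : W * (U * Y⁻¹) = Y - 1 := by
    rw [sub_eq_zero.1 e3, Matrix.mul_assoc, ← Matrix.mul_assoc G,
      show G * U = Y - 1 by rw [← e1]; abel, Matrix.sub_mul, hYi, Matrix.mul_sub, Matrix.mul_one,
      Matrix.one_mul, hYi]
  have hEΔ : E * Z - E * U * (G + Δ) = 1 := by
    rw [← hE1, ← e4]
    simp only [Matrix.mul_add, Matrix.mul_sub, Matrix.mul_assoc]
    abel
  set S : TransferMatrix (p ⊕ m) (p ⊕ m) :=
    Matrix.fromBlocks (Y + Y * Δ * (E * U)) (W + Y * Δ * (E * Z)) (E * U) (E * Z) with hS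
  have hS1 : S * (1 - realization (G + Δ) (U * Y⁻¹)) = 1 := by
    rw [one_sub_realization, hS, Matrix.fromBlocks_multiply, ← Matrix.fromBlocks_one,
      Matrix.fromBlocks_inj]
    simp only [Matrix.mul_one, Matrix.mul_neg, Matrix.add_mul]
    have hEZK : E * Z * (U * Y⁻¹) = E * U := by rw [Matrix.mul_assoc, hZK]
    refine ⟨?_, ?_, ?_, ?_⟩
    · rw [hWK, Matrix.mul_assoc (Y * Δ) (E * Z), hEZK]; abel
    · rw [Matrix.mul_assoc (Y * Δ) (E * U), eq_add_of_sub_eq hEΔ, sub_eq_zero.1 e3, Matrix.mul_add,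
        Matrix.mul_add (Y * Δ), Matrix.mul_add, Matrix.mul_one]
      abel
    · rw [hEZK]; abel
    · rw [← hEΔ]; abel
  refine ⟨S, mul_eq_one_comm.1 hS1, hS1, isRHInf_fromBlocks_iff.2 ⟨?_, ?_, ?_, ?_⟩⟩
  · exact hYs.add ((hYs.mul hΔ).mul (hE.mul hUs))
  · exact hWs.add ((hYs.mul hΔ).mul (hE.mul hZs))
  · exact hE.mul hUs
  · exact hE.mul hZs

/-- A small-gain theorem: a stable `L` whose gain is less than `1` has a stable `(1 - L)⁻¹`. -/
theorem IsRHInf.one_sub_inv {L : TransferMatrix m m} (hL : L.IsRHInf T) {ρ : ℝ} (hρ : ρ < 1)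
    (h : ∀ s ∈ T.openRegion, ‖L.evalAt s‖ ≤ ρ) :
    IsUnit (1 - L).det ∧ IsRHInf T (1 - L)⁻¹ := by
  have hreg : ∀ s ∈ T.openRegion, ∀ i j, L i j ∈ RatFunc.regularAt s := fun s hs =>
    hL.mem_regularAt (T.openRegion_subset_closedRegion hs)
  have heval : ∀ s ∈ T.openRegion, evalAt (1 - L) s = 1 - L.evalAt s := fun s hs => by
    rw [evalAt_sub (Matrix.one_apply_mem _) (hreg s hs), evalAt_one]
  have hreg' : ∀ s ∈ T.openRegion, ∀ i j, (1 - L) i j ∈ RatFunc.regularAt s := fun s hs i j =>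
    sub_mem (Matrix.one_apply_mem _ i j) (hreg s hs i j)
  have hdet : IsUnit (1 - L).det := by
    rw [isUnit_iff_ne_zero]
    intro h0
    have hs : ((2 : ℝ) : ℂ) ∈ T.openRegion := T.ofReal_mem_openRegion one_lt_two
    have h1 := evalAt_det (hreg' _ hs)
    rw [h0, heval _ hs, RatFunc.eval_zero] at h1
    have h2 := Matrix.isUnit_one_sub_of_l2_opNorm_lt_one ((h _ hs).trans_lt hρ)
    rw [Matrix.isUnit_iff_isUnit_det, ← h1] at h2
    exact not_isUnit_zero h2
  refine ⟨hdet, ?_⟩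
  obtain ⟨B, hB, hBreg⟩ := exists_finite_forall_mem_regularAt (1 - L)⁻¹
  refine isRHInf_of_bounded (C := ‖(1 : Matrix m m ℂ)‖ / (1 - ρ)) hB fun s hs hsB => ?_
  set X := evalAt (1 - L)⁻¹ s with hX
  have h1 : (1 - L.evalAt s) * X = 1 := by
    rw [← heval s hs, hX, ← evalAt_mul (hreg' s hs) (hBreg s hsB), Matrix.mul_nonsing_inv _ hdet,
      evalAt_one]
  have h2 : X = 1 + L.evalAt s * X := by rw [← h1, sub_mul, one_mul]; abel
  have h3 : ‖X‖ ≤ ‖(1 : Matrix m m ℂ)‖ + ρ * ‖X‖ :=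
    calc ‖X‖ = ‖1 + L.evalAt s * X‖ := by rw [← h2]
      _ ≤ ‖(1 : Matrix m m ℂ)‖ + ‖L.evalAt s * X‖ := norm_add_le _ _
      _ ≤ _ := by
        gcongr
        exact (Matrix.l2_opNorm_mul _ _).trans (by gcongr; exact h s hs)
  rw [le_div_iff₀ (by linarith)]
  linarith

/-- Sufficiency of the norm bound. -/
theorem IOPConstraints.internallyStabilizes_of_mem_uncertaintySet {G : TransferMatrix p m}
    {Y : TransferMatrix p p} {W : TransferMatrix p m} {U : TransferMatrix m p}
    {Z : TransferMatrix m m} (h : IOPConstraints T G Y W U Z) (hY : IsUnit Y.det) {ε : ℝ}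
    (hε : 0 < ε) (hU : U.hInfNorm T ≤ ENNReal.ofReal ε⁻¹) {Δ : TransferMatrix p m}
    (hΔ : Δ ∈ uncertaintySet T ε) : InternallyStabilizes T (U * Y⁻¹) (G + Δ) := by
  obtain ⟨δ, hδ0, hδ, hΔb⟩ := exists_bound_of_hInfNorm_lt hΔ
  have hΔs : Δ.IsRHInf T := isRHInf_of_bounded Set.finite_empty fun s hs _ => hΔb s hs
  have hUs : U.IsRHInf T := (iopConstraints_iff.1 h).2.2.2.1
  have hUb := (hInfNorm_le_ofReal_iff (inv_pos.2 hε).le).1 hU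
  obtain ⟨hd, hE⟩ := (hUs.mul hΔs).one_sub_inv (ρ := ε⁻¹ * δ)
    (by rw [inv_mul_lt_iff₀ hε, mul_one]; exact hδ) fun s hs => by
      rw [evalAt_mul (hUs.mem_regularAt (T.openRegion_subset_closedRegion hs))
        (hΔs.mem_regularAt (T.openRegion_subset_closedRegion hs))]
      exact (Matrix.l2_opNorm_mul _ _).trans
        (mul_le_mul (hUb s hs) (hΔb s hs) (norm_nonneg _) (inv_pos.2 hε).le)
  exact h.internallyStabilizes_add hY hΔs hE (Matrix.nonsing_inv_mul _ hd)

/-! ### Strictly proper plants -/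

/-- If `G` is strictly proper, then `Y = 1 + G U` reduces to the identity modulo the maximal ideal
of the ring of proper rational functions, so that it is invertible over this ring. -/
theorem IOPConstraints.isUnit_det_and_isProper {G : TransferMatrix p m} {Y : TransferMatrix p p}
    {W : TransferMatrix p m} {U : TransferMatrix m p} {Z : TransferMatrix m m}
    (h : IOPConstraints T G Y W U Z) (hG : G.IsStrictlyProper) :
    IsUnit Y.det ∧ IsProper (U * Y⁻¹) := by
  obtain ⟨⟨e1, -⟩, -, -, hUs, -⟩ := iopConstraints_iff.1 h
  have hGp : ∀ i j, G i j ∈ RatFunc.properRing := fun i j => RatFunc.mem_properRing.2 (hG i j).le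
  have hUp := isProper_iff.1 hUs.1
  set ι : RatFunc.properRing →+* RatFunc ℝ := RatFunc.properRing.subtype
  set r := IsLocalRing.residue RatFunc.properRing
  set G' : Matrix p m RatFunc.properRing := Matrix.of fun i j => ⟨G i j, hGp i j⟩
  set U' : Matrix m p RatFunc.properRing := Matrix.of fun i j => ⟨U i j, hUp i j⟩
  have hYι : ι.mapMatrix (1 + G' * U') = Y := by
    rw [eq_add_of_sub_eq e1, map_add, map_one]
    congr 1
    exact Matrix.map_mul
  have hr : r.mapMatrix (1 + G' * U') = 1 := by
    have h0 : G'.map r = 0 := by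
      ext i j
      exact RatFunc.residue_eq_zero_of_degree_lt (hGp i j) (hG i j)
    rw [map_add, map_one]
    change 1 + (G' * U').map r = 1
    rw [Matrix.map_mul, h0, Matrix.zero_mul, add_zero]
  have hu : IsUnit (1 + G' * U').det := by
    rw [← IsLocalRing.residue_ne_zero_iff_isUnit, RingHom.map_det, hr, Matrix.det_one]
    exact one_ne_zero
  have hmul := congrArg ι.mapMatrix (Matrix.mul_nonsing_inv (1 + G' * U') hu)
  rw [map_mul, hYι, map_one] at hmul
  refine ⟨?_, isProper_iff.2 ?_⟩
  · rw [← hYι, ← RingHom.map_det]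
    exact hu.map ι
  rw [Matrix.inv_eq_right_inv hmul]
  exact Matrix.mul_apply_mem RatFunc.properRing.toSubring hUp
    fun i j => ((1 + G' * U' : Matrix p p RatFunc.properRing)⁻¹ i j).property

end TransferMatrix

/-! ### The unstable region as a disc -/

/-- The numerator of the Möbius map from the closed unit disc onto the closed unstable region with
the point at infinity: `q ↦ (1 + q) / (1 - q)` in continuous time, `q ↦ 1 / q` in discrete time. -/
def TimeSetting.discNum : TimeSetting → ℂ → ℂ
  | .continuous => fun q => 1 + q
  | .discrete => fun _ => 1

/-- The denominator of the Möbius map from the closed unit disc; it vanishes at the one point that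
is mapped to infinity. -/
def TimeSetting.discDen : TimeSetting → ℂ → ℂ
  | .continuous => fun q => 1 - q
  | .discrete => fun q => q

theorem TimeSetting.differentiable_discNum (T : TimeSetting) : Differentiable ℂ T.discNum := by
  cases T <;> unfold TimeSetting.discNum <;> fun_prop

theorem TimeSetting.differentiable_discDen (T : TimeSetting) : Differentiable ℂ T.discDen := by
  cases T <;> unfold TimeSetting.discDen <;> fun_prop

theorem TimeSetting.discNum_ne_zero {T : TimeSetting} {q : ℂ} (h : T.discDen q = 0) :
    T.discNum q ≠ 0 := by
  cases T
  · have hq : q = 1 := (sub_eq_zero.1 h).symm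
    simp only [TimeSetting.discNum, hq]
    norm_num
  · exact one_ne_zero

theorem TimeSetting.discNum_div_discDen_mem_closedRegion {T : TimeSetting} {q : ℂ} (hq : ‖q‖ ≤ 1)
    (h : T.discDen q ≠ 0) : T.discNum q / T.discDen q ∈ T.closedRegion := by
  cases T
  · change 0 ≤ ((1 + q) / (1 - q)).re
    have h1 : q.re * q.re + q.im * q.im ≤ 1 := by
      rw [← Complex.normSq_apply, Complex.normSq_eq_norm_sq]
      exact pow_le_one₀ (norm_nonneg q) hq
    rw [Complex.div_re, ← add_div]
    refine div_nonneg ?_ (Complex.normSq_nonneg _)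
    simp only [Complex.add_re, Complex.one_re, Complex.sub_re, Complex.add_im, Complex.one_im,
      Complex.sub_im]
    nlinarith
  · change 1 ≤ ‖1 / q‖
    have h0 : 0 < ‖q‖ := norm_pos_iff.2 h
    rw [norm_div, norm_one, one_le_div h0]
    exact hq

theorem TimeSetting.exists_discNum_div_discDen_eq {T : TimeSetting} {s : ℂ}
    (hs : s ∈ T.openRegion) :
    ∃ q, ‖q‖ ≤ 1 ∧ T.discDen q ≠ 0 ∧ T.discNum q / T.discDen q = s := by
  cases T
  · have hs : 0 < s.re := hs
    have h1 : s + 1 ≠ 0 := fun h => by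
      have := congrArg Complex.re h
      simp at this; linarith
    have h2 : 1 - (s - 1) / (s + 1) = 2 / (s + 1) := by field_simp; ring
    refine ⟨(s - 1) / (s + 1), ?_, ?_, ?_⟩
    · rw [norm_div]
      refine div_le_one_of_le₀ ?_ (norm_nonneg _)
      rw [Complex.norm_def, Complex.norm_def]
      refine Real.sqrt_le_sqrt ?_
      simp only [Complex.normSq_apply, Complex.sub_re, Complex.sub_im, Complex.add_re,
        Complex.add_im, Complex.one_re, Complex.one_im]
      nlinarith
    · change 1 - (s - 1) / (s + 1) ≠ 0
      rw [h2]
      exact div_ne_zero two_ne_zero h1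
    · change (1 + (s - 1) / (s + 1)) / (1 - (s - 1) / (s + 1)) = s
      rw [h2]
      field_simp
      ring
  · have hs : 1 < ‖s‖ := hs
    have h0 : s ≠ 0 := norm_pos_iff.1 (one_pos.trans hs)
    refine ⟨s⁻¹, ?_, inv_ne_zero h0, ?_⟩
    · rw [norm_inv]
      exact inv_le_one_of_one_le₀ hs.le
    · change 1 / s⁻¹ = s
      rw [one_div, inv_inv]

open Polynomial in
/-- The homogenization of degree `N` of a polynomial, evaluated at `(a, b)`. -/
noncomputable def Polynomial.homogenizedEval (P : ℝ[X]) (N : ℕ) (a b : ℂ) : ℂ :=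
  ∑ k ∈ Finset.range (N + 1), (P.coeff k : ℂ) * a ^ k * b ^ (N - k)

open Polynomial in
theorem Polynomial.homogenizedEval_of_ne_zero {P : ℝ[X]} {N : ℕ} (hN : P.natDegree ≤ N) (a : ℂ)
    {b : ℂ} (hb : b ≠ 0) : P.homogenizedEval N a b = b ^ N * aeval (a / b) P := by
  rw [aeval_eq_sum_range' (Nat.lt_succ_of_le hN), Finset.mul_sum, homogenizedEval]
  refine Finset.sum_congr rfl fun k hk => ?_
  have hk : k ≤ N := Nat.lt_succ_iff.1 (Finset.mem_range.1 hk)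
  rw [Algebra.smul_def, Complex.coe_algebraMap, div_pow, pow_sub₀ b hb hk]
  field_simp

open Polynomial in
theorem Polynomial.homogenizedEval_zero_right (P : ℝ[X]) (N : ℕ) (a : ℂ) :
    P.homogenizedEval N a 0 = P.coeff N * a ^ N := by
  rw [homogenizedEval, Finset.sum_eq_single N]
  · simp
  · intro k hk hkN
    have : N - k ≠ 0 := by have := Finset.mem_range.1 hk; omega
    simp [this]
  · simp

/-- In the coordinate of the disc, a stable rational function extends to a function that is
holomorphic on the closed disc, the point at infinity included. -/
theorem RatFunc.exists_differentiableOn_closedBall {T : TimeSetting} {f : RatFunc ℝ}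
    (hf : f ∈ RatFunc.stableRing T) :
    ∃ F : ℂ → ℂ, DifferentiableOn ℂ F (Metric.closedBall 0 1) ∧
      ∀ q, ‖q‖ ≤ 1 → T.discDen q ≠ 0 →
        F q = f.eval (algebraMap ℝ ℂ) (T.discNum q / T.discDen q) := by
  obtain ⟨hp, hr⟩ := RatFunc.mem_stableRing.1 hf
  set N := f.denom.natDegree
  have hN : f.num.natDegree ≤ N :=
    Polynomial.natDegree_le_natDegree (RatFunc.mem_properRing.1 hp)
  have hdiff : ∀ P : Polynomial ℝ,
      Differentiable ℂ fun q => P.homogenizedEval N (T.discNum q) (T.discDen q) := fun P => by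
    have := T.differentiable_discNum
    have := T.differentiable_discDen
    unfold Polynomial.homogenizedEval
    fun_prop
  refine ⟨fun q => f.num.homogenizedEval N (T.discNum q) (T.discDen q) /
    f.denom.homogenizedEval N (T.discNum q) (T.discDen q), ?_, fun q hq hβ => ?_⟩
  · refine (hdiff _).differentiableOn.div (hdiff _).differentiableOn fun q hq => ?_
    rw [mem_closedBall_zero_iff] at hq
    by_cases hβ : T.discDen q = 0
    · rw [hβ, Polynomial.homogenizedEval_zero_right]
      refine mul_ne_zero ?_ (pow_ne_zero _ (TimeSetting.discNum_ne_zero hβ))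
      exact Complex.ofReal_ne_zero.2 (Polynomial.leadingCoeff_ne_zero.2 f.denom_ne_zero)
    · rw [Polynomial.homogenizedEval_of_ne_zero le_rfl _ hβ]
      exact mul_ne_zero (pow_ne_zero _ hβ)
        (hr _ (TimeSetting.discNum_div_discDen_mem_closedRegion hq hβ))
  · change Polynomial.homogenizedEval _ _ _ _ / Polynomial.homogenizedEval _ _ _ _ = _
    rw [Polynomial.homogenizedEval_of_ne_zero hN _ hβ,
      Polynomial.homogenizedEval_of_ne_zero le_rfl _ hβ,
      mul_div_mul_left _ _ (pow_ne_zero _ hβ)]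
    rfl

/-- The maximum modulus principle on the unit disc, with the bound only assumed at the points of
the circle that are not real. -/
theorem Complex.norm_le_of_forall_sphere_im_ne_zero {E : Type*} [NormedAddCommGroup E]
    [NormedSpace ℂ E] {g : ℂ → E} (hg : DifferentiableOn ℂ g (Metric.closedBall 0 1)) {C : ℝ}
    (h : ∀ q : ℂ, ‖q‖ = 1 → q.im ≠ 0 → ‖g q‖ ≤ C) {q : ℂ} (hq : ‖q‖ ≤ 1) : ‖g q‖ ≤ C := by
  have hcl : closure (Metric.ball (0 : ℂ) 1) = Metric.closedBall 0 1 :=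
    closure_ball _ one_ne_zero
  refine Complex.norm_le_of_forall_mem_frontier_norm_le (U := Metric.ball 0 1)
    Metric.isBounded_ball (DifferentiableOn.diffContOnCl (hcl.symm ▸ hg)) (fun z hz => ?_)
    (by rw [hcl, mem_closedBall_zero_iff]; exact hq)
  rw [frontier_ball _ one_ne_zero, mem_sphere_zero_iff_norm] at hz
  have hmem : ∀ t : ℝ, Complex.exp (t * Complex.I) ∈ Metric.closedBall (0 : ℂ) 1 := fun t => by
    rw [mem_closedBall_zero_iff, Complex.norm_exp_ofReal_mul_I]
  have hcont : Continuous fun t : ℝ => ‖g (Complex.exp (t * Complex.I))‖ :=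
    (hg.continuousOn.comp_continuous (by fun_prop) hmem).norm
  have hdense : Dense {t : ℝ | Real.sin t = 0}ᶜ := by
    refine Set.Countable.dense_compl ℝ ((Set.countable_range fun n : ℤ => n * Real.pi).mono ?_)
    exact fun t ht => Real.sin_eq_zero_iff.1 ht
  have hall : ∀ t : ℝ, ‖g (Complex.exp (t * Complex.I))‖ ≤ C := fun t => by
    refine closure_minimal (s := {t : ℝ | Real.sin t = 0}ᶜ)
      (t := {t | ‖g (Complex.exp (t * Complex.I))‖ ≤ C}) (fun t ht => ?_)
      (isClosed_le hcont continuous_const) (hdense t)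
    refine h _ (Complex.norm_exp_ofReal_mul_I t) ?_
    rw [Complex.exp_ofReal_mul_I_im]
    exact ht
  have h1 := hall z.arg
  have h2 := Complex.norm_mul_exp_arg_mul_I z
  rw [hz, Complex.ofReal_one, one_mul] at h2
  rwa [h2] at h1

namespace TransferMatrix

open scoped Matrix Matrix.Norms.L2Operator

/-- The `H∞` norm of a stable transfer matrix is the supremum over the boundary; the points of the
boundary where a real-rational function takes real values can be left out. -/
theorem IsRHInf.hInfNorm_le_of_forall_circle {p m : Type*} [Fintype p] [Fintype m] [DecidableEq m]
    {T : TimeSetting} {M : TransferMatrix p m} (hM : M.IsRHInf T) {C : ℝ} (hC : 0 ≤ C)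
    (h : ∀ q : ℂ, ‖q‖ = 1 → q.im ≠ 0 → T.discDen q ≠ 0 →
      ‖M.evalAt (T.discNum q / T.discDen q)‖ ≤ C) :
    M.hInfNorm T ≤ ENNReal.ofReal C := by
  rw [hInfNorm_le_ofReal_iff hC]
  intro s hs
  obtain ⟨q₀, hq₀, hβ₀, rfl⟩ := TimeSetting.exists_discNum_div_discDen_eq hs
  choose F hF hFeq using fun i j =>
    RatFunc.exists_differentiableOn_closedBall (isRHInf_iff.1 hM i j)
  have hval : ∀ q, ‖q‖ ≤ 1 → T.discDen q ≠ 0 →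
      (Matrix.of fun i j => F i j q) = M.evalAt (T.discNum q / T.discDen q) := fun q hq hβ => by
    ext i j
    exact hFeq i j q hq hβ
  refine Matrix.l2_opNorm_le_of_forall hC fun x => ?_
  rw [← hval q₀ hq₀ hβ₀]
  refine Complex.norm_le_of_forall_sphere_im_ne_zero
    (g := fun q => WithLp.toLp 2 ((Matrix.of fun i j => F i j q) *ᵥ x.ofLp)) ?_
    (fun q hq him => ?_) hq₀
  · rw [differentiableOn_euclidean]
    intro i
    simp only [Matrix.mulVec, dotProduct, Matrix.of_apply]
    exact DifferentiableOn.fun_sum fun j _ => (hF i j).mul_const _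
  · -- The point that is mapped to infinity is real.
    have hβ : T.discDen q ≠ 0 := by
      intro h0
      apply him
      cases T
      · rw [← sub_eq_zero.1 h0, Complex.one_im]
      · rw [show q = 0 from h0, Complex.zero_im]
    simp only [hval q hq.le hβ]
    exact (Matrix.l2_opNorm_mulVec _ x).trans (by gcongr; exact h q hq him hβ)

end TransferMatrix

/-! ### Interpolation by real-rational all-pass functions -/

open Polynomial in
/-- The numerator of the inverse Möbius map, from the unstable region to the disc. -/
noncomputable def TimeSetting.toDiscNum : TimeSetting → ℝ[X]
  | .continuous => X - 1
  | .discrete => 1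

open Polynomial in
/-- The denominator of the inverse Möbius map. -/
noncomputable def TimeSetting.toDiscDen : TimeSetting → ℝ[X]
  | .continuous => X + 1
  | .discrete => X

open Polynomial in
theorem TimeSetting.aeval_toDiscDen_ne_zero {T : TimeSetting} {q : ℂ} (h : T.discDen q ≠ 0) :
    aeval (T.discNum q / T.discDen q) T.toDiscDen ≠ 0 := by
  cases T
  · have h : 1 - q ≠ 0 := h
    change aeval ((1 + q) / (1 - q)) (X + 1 : ℝ[X]) ≠ 0
    have h2 : (1 + q) / (1 - q) + 1 = 2 / (1 - q) := by field_simp; ring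
    rw [map_add, aeval_X, map_one, h2]
    exact div_ne_zero two_ne_zero h
  · change aeval (1 / q) (X : ℝ[X]) ≠ 0
    rw [aeval_X]
    exact one_div_ne_zero h

open Polynomial in
theorem TimeSetting.aeval_toDiscNum {T : TimeSetting} {q : ℂ} (h : T.discDen q ≠ 0) :
    aeval (T.discNum q / T.discDen q) T.toDiscNum =
      q * aeval (T.discNum q / T.discDen q) T.toDiscDen := by
  cases T
  · have h : 1 - q ≠ 0 := h
    change aeval ((1 + q) / (1 - q)) (X - 1 : ℝ[X]) = q * aeval ((1 + q) / (1 - q)) (X + 1 : ℝ[X])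
    simp only [map_add, map_sub, aeval_X, map_one]
    field_simp
    ring
  · have h : q ≠ 0 := h
    change aeval (1 / q) (1 : ℝ[X]) = q * aeval (1 / q) (X : ℝ[X])
    rw [aeval_X, map_one, mul_one_div_cancel h]

theorem Complex.one_sub_ofReal_mul_ne_zero {a : ℝ} (ha : |a| < 1) {q : ℂ} (hq : ‖q‖ ≤ 1) :
    1 - a * q ≠ 0 := by
  intro h
  have h1 : ‖(a : ℂ) * q‖ = 1 := by rw [← sub_eq_zero.1 h, norm_one]
  rw [norm_mul, Complex.norm_real, Real.norm_eq_abs] at h1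
  have := mul_le_of_le_one_right (abs_nonneg a) hq
  linarith

theorem Complex.norm_sub_div_one_sub_mul_le_one {a : ℝ} (ha : |a| < 1) {q : ℂ} (hq : ‖q‖ ≤ 1) :
    ‖(q - a) / (1 - a * q)‖ ≤ 1 := by
  rw [norm_div]
  refine div_le_one_of_le₀ ?_ (norm_nonneg _)
  rw [Complex.norm_def, Complex.norm_def]
  refine Real.sqrt_le_sqrt ?_
  have h1 : q.re * q.re + q.im * q.im ≤ 1 := by
    rw [← Complex.normSq_apply, Complex.normSq_eq_norm_sq]
    exact pow_le_one₀ (norm_nonneg q) hq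
  have h2 : a ^ 2 ≤ 1 := ((sq_lt_one_iff_abs_lt_one a).2 ha).le
  simp only [Complex.normSq_apply, Complex.sub_re, Complex.sub_im, Complex.mul_re, Complex.mul_im,
    Complex.ofReal_re, Complex.ofReal_im, Complex.one_re, Complex.one_im]
  nlinarith [mul_nonneg (sub_nonneg.2 h1) (sub_nonneg.2 h2)]

/-- A disc automorphism with a real parameter maps a given unimodular number to any other one on
the same side of the real axis. -/
theorem Complex.exists_real_sub_div_one_sub_mul_eq {q e : ℂ} (hq : ‖q‖ = 1) (he : ‖e‖ = 1)
    (h : 0 < q.im * e.im) : ∃ a : ℝ, |a| < 1 ∧ (q - a) / (1 - a * q) = e := by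
  have hq2 : q.re * q.re + q.im * q.im = 1 := by
    rw [← Complex.normSq_apply, Complex.normSq_eq_norm_sq, hq, one_pow]
  have he2 : e.re * e.re + e.im * e.im = 1 := by
    rw [← Complex.normSq_apply, Complex.normSq_eq_norm_sq, he, one_pow]
  have hqr := abs_le.1 ((Complex.abs_re_le_norm q).trans_eq hq)
  have her := abs_le.1 ((Complex.abs_re_le_norm e).trans_eq he)
  set D := 1 - q.re * e.re + q.im * e.im with hD
  have h1 : q.re - e.re < D := by nlinarith
  have h2 : -D < q.re - e.re := by nlinarith
  have hDpos : 0 < D := by linarith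
  have ha : |(q.re - e.re) / D| < 1 := by
    rw [abs_div, abs_of_pos hDpos, div_lt_one hDpos, abs_lt]
    exact ⟨h2, h1⟩
  -- The only candidate is `(q - e) / (1 - q e)`; it is real, and rationalizing gives this form.
  refine ⟨(q.re - e.re) / D, ha, ?_⟩
  rw [div_eq_iff (Complex.one_sub_ofReal_mul_ne_zero ha hq.le), Complex.ofReal_div]
  have hDc : (D : ℂ) ≠ 0 := Complex.ofReal_ne_zero.2 hDpos.ne'
  have key : (D : ℂ) * (q - e) = ((q.re - e.re : ℝ) : ℂ) * (1 - e * q) := by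
    apply Complex.ext
    · simp only [Complex.mul_re, Complex.sub_re, Complex.sub_im, Complex.ofReal_re,
        Complex.ofReal_im, Complex.one_re, Complex.one_im, Complex.mul_im, hD]
      ring
    · simp only [Complex.mul_re, Complex.sub_re, Complex.sub_im, Complex.ofReal_re,
        Complex.ofReal_im, Complex.one_re, Complex.one_im, Complex.mul_im, hD]
      linear_combination e.im * hq2 - q.im * he2
  field_simp
  linear_combination key

namespace RatFunc

open Polynomial

variable {T : TimeSetting}

theorem neg_eval {s : ℂ} {f : RatFunc ℝ} (hf : f ∈ regularAt s) :
    (-f).eval (algebraMap ℝ ℂ) s = -f.eval (algebraMap ℝ ℂ) s :=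
  map_neg (evalRegular s) ⟨f, hf⟩

/-- A real-rational function with `q ↦ (q - a) / (1 - a q)` as its form in the coordinate of the
disc. -/
theorem exists_allPass {a : ℝ} (ha : |a| < 1) :
    ∃ b ∈ stableRing T, ∀ q, ‖q‖ ≤ 1 → T.discDen q ≠ 0 →
      b.eval (algebraMap ℝ ℂ) (T.discNum q / T.discDen q) = (q - a) / (1 - a * q) := by
  set b : RatFunc ℝ := algebraMap ℝ[X] _ (T.toDiscNum - Polynomial.C a * T.toDiscDen) /
    algebraMap ℝ[X] _ (T.toDiscDen - Polynomial.C a * T.toDiscNum)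
  have hb : ∀ q, ‖q‖ ≤ 1 → T.discDen q ≠ 0 →
      b.eval (algebraMap ℝ ℂ) (T.discNum q / T.discDen q) = (q - a) / (1 - a * q) := by
    intro q hq hβ
    have h1 := TimeSetting.aeval_toDiscDen_ne_zero hβ
    have h2 := TimeSetting.aeval_toDiscNum hβ
    have h3 := Complex.one_sub_ofReal_mul_ne_zero ha hq
    have h4 : aeval (T.discNum q / T.discDen q) (T.toDiscDen - Polynomial.C a * T.toDiscNum) =
        aeval (T.discNum q / T.discDen q) T.toDiscDen * (1 - a * q) := by
      rw [map_sub, map_mul, aeval_C, h2, Complex.coe_algebraMap]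
      ring
    have h5 : aeval (T.discNum q / T.discDen q) (T.toDiscNum - Polynomial.C a * T.toDiscDen) =
        aeval (T.discNum q / T.discDen q) T.toDiscDen * (q - a) := by
      rw [map_sub, map_mul, aeval_C, h2, Complex.coe_algebraMap]
      ring
    rw [eval_div_of_ne_zero _ _ (by rw [h4]; exact mul_ne_zero h1 h3), h4, h5,
      mul_div_mul_left _ _ h1]
  refine ⟨b, mem_stableRing_of_bounded (C := 1) Set.finite_empty fun s hs _ => ?_, hb⟩
  obtain ⟨q, hq, hβ, rfl⟩ := TimeSetting.exists_discNum_div_discDen_eq hs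
  rw [hb q hq hβ]
  exact Complex.norm_sub_div_one_sub_mul_le_one ha hq

theorem exists_stable_eval_eq_of_norm_eq_one {q e : ℂ} (hq : ‖q‖ = 1) (hqi : q.im ≠ 0)
    (hβ : T.discDen q ≠ 0) (he : ‖e‖ = 1) :
    ∃ b ∈ stableRing T, b.eval (algebraMap ℝ ℂ) (T.discNum q / T.discDen q) = e ∧
      ∀ s ∈ T.openRegion, ‖b.eval (algebraMap ℝ ℂ) s‖ ≤ 1 := by
  have hs₀ := TimeSetting.discNum_div_discDen_mem_closedRegion hq.le hβ
  have hreg : ∀ {b : RatFunc ℝ}, b ∈ stableRing T → ∀ s ∈ T.closedRegion, b ∈ regularAt s :=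
    fun hb => (mem_stableRing.1 hb).2
  -- The case of a target on the same side of the real axis.
  have main : ∀ e : ℂ, ‖e‖ = 1 → 0 < q.im * e.im → ∃ b ∈ stableRing T,
      b.eval (algebraMap ℝ ℂ) (T.discNum q / T.discDen q) = e ∧
        ∀ s ∈ T.openRegion, ‖b.eval (algebraMap ℝ ℂ) s‖ ≤ 1 := by
    intro e he h
    obtain ⟨a, ha, hae⟩ := Complex.exists_real_sub_div_one_sub_mul_eq hq he h
    obtain ⟨b, hb, hbe⟩ := exists_allPass (T := T) ha
    refine ⟨b, hb, by rw [hbe q hq.le hβ, hae], fun s hs => ?_⟩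
    obtain ⟨q', hq', hβ', rfl⟩ := TimeSetting.exists_discNum_div_discDen_eq hs
    rw [hbe q' hq' hβ']
    exact Complex.norm_sub_div_one_sub_mul_le_one ha hq'
  -- The set of admissible targets is symmetric.
  have neg : (∃ b ∈ stableRing T, b.eval (algebraMap ℝ ℂ) (T.discNum q / T.discDen q) = -e ∧
      ∀ s ∈ T.openRegion, ‖b.eval (algebraMap ℝ ℂ) s‖ ≤ 1) →
      ∃ b ∈ stableRing T, b.eval (algebraMap ℝ ℂ) (T.discNum q / T.discDen q) = e ∧
        ∀ s ∈ T.openRegion, ‖b.eval (algebraMap ℝ ℂ) s‖ ≤ 1 := by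
    rintro ⟨b, hb, hbe, hb1⟩
    refine ⟨-b, neg_mem hb, by rw [neg_eval (hreg hb _ hs₀), hbe, neg_neg], fun s hs => ?_⟩
    rw [neg_eval (hreg hb _ (T.openRegion_subset_closedRegion hs)), norm_neg]
    exact hb1 s hs
  have one : ∃ b ∈ stableRing T, b.eval (algebraMap ℝ ℂ) (T.discNum q / T.discDen q) = 1 ∧
      ∀ s ∈ T.openRegion, ‖b.eval (algebraMap ℝ ℂ) s‖ ≤ 1 :=
    ⟨1, one_mem _, eval_one _ _, fun s _ => by rw [eval_one, norm_one]⟩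
  rcases lt_trichotomy (q.im * e.im) 0 with h | h | h
  · refine neg (main (-e) (by rw [norm_neg, he]) ?_)
    rw [Complex.neg_im]
    linarith
  · have hei : e.im = 0 := (mul_eq_zero.1 h).resolve_left hqi
    have hee : e = (e.re : ℂ) := Complex.ext rfl (by simp [hei])
    rw [hee, Complex.norm_real, Real.norm_eq_abs] at he
    rcases eq_or_eq_neg_of_abs_eq he with h1 | h1
    · rw [hee, h1, Complex.ofReal_one]
      exact one
    · refine neg ?_
      rw [hee, h1, Complex.ofReal_neg, Complex.ofReal_one, neg_neg]
      exact one
  · exact main e he h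

/-- At a boundary point that is not real, a stable real-rational function can take any prescribed
value, with the modulus of this value as a bound on the open region. -/
theorem exists_stable_eval_eq {q : ℂ} (hq : ‖q‖ = 1) (hqi : q.im ≠ 0)
    (hβ : T.discDen q ≠ 0) (c : ℂ) :
    ∃ b ∈ stableRing T, b.eval (algebraMap ℝ ℂ) (T.discNum q / T.discDen q) = c ∧
      ∀ s ∈ T.openRegion, ‖b.eval (algebraMap ℝ ℂ) s‖ ≤ ‖c‖ := by
  by_cases hc : c = 0
  · exact ⟨0, zero_mem _, by rw [eval_zero, hc], fun s _ => by
      rw [eval_zero, norm_zero]; positivity⟩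
  have hc' : (‖c‖ : ℂ) ≠ 0 := Complex.ofReal_ne_zero.2 (norm_ne_zero_iff.2 hc)
  obtain ⟨b, hb, hbe, hb1⟩ := exists_stable_eval_eq_of_norm_eq_one hq hqi hβ
    (e := c / ‖c‖)
    (by rw [norm_div, Complex.norm_real, norm_norm, div_self (norm_ne_zero_iff.2 hc)])
  have hCr : ∀ s : ℂ, C ‖c‖ ∈ regularAt s := fun s => by simp [mem_regularAt]
  have hCp : C ‖c‖ ∈ stableRing T := mem_stableRing.2
    ⟨mem_properRing.2 (by simpa using Polynomial.degree_C_le), fun s _ => hCr s⟩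
  have heval : ∀ s ∈ T.closedRegion, (C ‖c‖ * b).eval (algebraMap ℝ ℂ) s =
      ‖c‖ * b.eval (algebraMap ℝ ℂ) s := fun s hs => by
    rw [eval_mul (algebraMap ℝ ℂ) s (hCr s) ((mem_stableRing.1 hb).2 s hs), eval_C,
      Complex.coe_algebraMap]
  refine ⟨C ‖c‖ * b, mul_mem hCp hb, ?_, fun s hs => ?_⟩
  · rw [heval _ (TimeSetting.discNum_div_discDen_mem_closedRegion hq.le hβ), hbe,
      mul_div_cancel₀ _ hc']
  · rw [heval s (T.openRegion_subset_closedRegion hs), norm_mul, Complex.norm_real, norm_norm]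
    exact mul_le_of_le_one_right (norm_nonneg c) (hb1 s hs)

end RatFunc

namespace TransferMatrix

open scoped Matrix Matrix.Norms.L2Operator

variable {p m : Type*} [Fintype p] [Fintype m] [DecidableEq m] {T : TimeSetting}

/-- A real-rational stable matrix with a prescribed value of rank one at a boundary point that is
not real, bounded on the open region by the norm of this value. -/
theorem exists_stable_evalAt_eq_vecMulVec {q : ℂ} (hq : ‖q‖ = 1) (hqi : q.im ≠ 0)
    (hβ : T.discDen q ≠ 0) (x : EuclideanSpace ℂ p) (y : EuclideanSpace ℂ m) :
    ∃ Δ : TransferMatrix p m, Δ.IsRHInf T ∧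
      Δ.evalAt (T.discNum q / T.discDen q) = Matrix.vecMulVec x.ofLp y.ofLp ∧
      ∀ s ∈ T.openRegion, ‖Δ.evalAt s‖ ≤ ‖x‖ * ‖y‖ := by
  choose b hb hbe hb1 using fun i => RatFunc.exists_stable_eval_eq hq hqi hβ (x i)
  choose c hc hce hc1 using fun j => RatFunc.exists_stable_eval_eq hq hqi hβ (y j)
  have heval : ∀ s ∈ T.closedRegion, evalAt (Matrix.of fun i j => b i * c j) s =
      Matrix.vecMulVec (fun i => (b i).eval (algebraMap ℝ ℂ) s)
        (fun j => (c j).eval (algebraMap ℝ ℂ) s) := fun s hs => by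
    ext i j
    exact RatFunc.eval_mul _ _ ((RatFunc.mem_stableRing.1 (hb i)).2 s hs)
      ((RatFunc.mem_stableRing.1 (hc j)).2 s hs)
  refine ⟨Matrix.of fun i j => b i * c j, isRHInf_iff.2 fun i j => mul_mem (hb i) (hc j), ?_,
    fun s hs => ?_⟩
  · rw [heval _ (TimeSetting.discNum_div_discDen_mem_closedRegion hq.le hβ)]
    simp only [hbe, hce]
  · rw [heval s (T.openRegion_subset_closedRegion hs)]
    refine (Matrix.l2_opNorm_vecMulVec_le (WithLp.toLp 2 fun i => (b i).eval (algebraMap ℝ ℂ) s)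
      (WithLp.toLp 2 fun j => (c j).eval (algebraMap ℝ ℂ) s)).trans ?_
    simp only [EuclideanSpace.norm_eq]
    gcongr with i _ j _
    · exact hb1 i s hs
    · exact hc1 j s hs

/-! ### Necessity of the norm bound -/

/-- If `U` has gain greater than `ε⁻¹` in a direction `x` at a boundary point `s₀`, then some
uncertainty `Δ` of norm less than `ε` maps `U(s₀) x` back to `x`. The loop with `G + Δ` has the
parameter `U' = U (1 - Δ U)⁻¹`, which cannot be stable since `1 - Δ U` annihilates `x` at `s₀` and
`U` does not. -/
theorem hInfNorm_le_of_internallyStabilizes [DecidableEq p] {G : TransferMatrix p m}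
    {K : TransferMatrix m p} {Y : TransferMatrix p p} {U : TransferMatrix m p} {ε : ℝ} (hε : 0 < ε)
    (hK : ∀ Δ ∈ (uncertaintySet T ε : Set (TransferMatrix p m)), InternallyStabilizes T K (G + Δ))
    (hUs : U.IsRHInf T) (hUK : U = K * Y) (hY : (1 - G * K) * Y = 1) :
    U.hInfNorm T ≤ ENNReal.ofReal ε⁻¹ := by
  refine hUs.hInfNorm_le_of_forall_circle (inv_pos.2 hε).le fun q hq hqi hβ => ?_
  set s₀ := T.discNum q / T.discDen q with hs₀
  have hs₀c : s₀ ∈ T.closedRegion := TimeSetting.discNum_div_discDen_mem_closedRegion hq.le hβ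
  refine Matrix.l2_opNorm_le_of_forall (inv_pos.2 hε).le fun x => ?_
  by_contra! hx
  set y : EuclideanSpace ℂ m := WithLp.toLp 2 (U.evalAt s₀ *ᵥ x.ofLp) with hy
  have hy0 : 0 < ‖y‖ := lt_of_le_of_lt (by positivity) hx
  set y' : EuclideanSpace ℂ m := ((‖y‖ ^ 2 : ℝ) : ℂ)⁻¹ • WithLp.toLp 2 (star y.ofLp) with hy'
  have hy'n : ‖y'‖ = ‖y‖⁻¹ := by
    have h3 : ‖(WithLp.toLp 2 (star y.ofLp) : EuclideanSpace ℂ m)‖ = ‖y‖ := by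
      simp [EuclideanSpace.norm_eq]
    rw [hy', norm_smul, h3, norm_inv, Complex.norm_real, norm_pow, norm_norm]
    field_simp
  have hy'y : y'.ofLp ⬝ᵥ y.ofLp = 1 := by
    have h3 : star y.ofLp ⬝ᵥ y.ofLp = ((‖y‖ ^ 2 : ℝ) : ℂ) := by
      rw [dotProduct_comm, ← EuclideanSpace.inner_eq_star_dotProduct, inner_self_eq_norm_sq_to_K]
      simp
    rw [hy', WithLp.ofLp_smul, smul_dotProduct, h3, smul_eq_mul, inv_mul_cancel₀]
    exact Complex.ofReal_ne_zero.2 (by positivity)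
  obtain ⟨Δ, hΔs, hΔe, hΔb⟩ := exists_stable_evalAt_eq_vecMulVec hq hqi hβ x y'
  have hΔ : Δ ∈ (uncertaintySet T ε : Set (TransferMatrix p m)) := by
    refine lt_of_le_of_lt ((hInfNorm_le_ofReal_iff (by positivity)).2 hΔb) ?_
    rw [ENNReal.ofReal_lt_ofReal_iff hε, hy'n, ← div_eq_mul_inv, div_lt_iff₀ hy0]
    rwa [inv_mul_lt_iff₀ hε] at hx
  obtain ⟨Y', W', U', Z', hiop, hU', hY'⟩ := (hK Δ hΔ).exists_parameters
  have hU's : U'.IsRHInf T := (iopConstraints_iff.1 hiop).2.2.2.1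
  have hrel : U' * (1 - Δ * U) = U := by
    have h1 : 1 - Δ * U = (1 - (G + Δ) * K) * Y := by
      rw [hUK, Matrix.add_mul, ← sub_sub, Matrix.sub_mul _ (Δ * K), hY, Matrix.mul_assoc]
    rw [h1, hU', Matrix.mul_assoc, ← Matrix.mul_assoc Y', mul_eq_one_comm.1 hY', Matrix.one_mul,
      hUK]
  have hΔU := hΔs.mul hUs
  have hreg : ∀ i j, (1 - Δ * U : TransferMatrix p p) i j ∈ RatFunc.regularAt s₀ := fun i j =>
    sub_mem (Matrix.one_apply_mem _ i j) (hΔU.mem_regularAt hs₀c i j)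
  have hev : U.evalAt s₀ = U'.evalAt s₀ * (1 - Δ.evalAt s₀ * U.evalAt s₀) := by
    conv_lhs => rw [← hrel]
    rw [evalAt_mul (hU's.mem_regularAt hs₀c) hreg,
      evalAt_sub (Matrix.one_apply_mem _) (hΔU.mem_regularAt hs₀c), evalAt_one,
      evalAt_mul (hΔs.mem_regularAt hs₀c) (hUs.mem_regularAt hs₀c)]
  have hker : (1 - Δ.evalAt s₀ * U.evalAt s₀) *ᵥ x.ofLp = 0 := by
    have h1 : Δ.evalAt s₀ *ᵥ y.ofLp = x.ofLp := by
      rw [hΔe, Matrix.vecMulVec_mulVec, hy'y]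
      simp
    rw [Matrix.sub_mulVec, Matrix.one_mulVec, ← Matrix.mulVec_mulVec]
    exact sub_eq_zero.2 h1.symm
  have hy00 : y = 0 := by
    rw [hy, hev, ← Matrix.mulVec_mulVec, hker, Matrix.mulVec_zero, WithLp.toLp_zero]
  rw [hy00, norm_zero] at hy0
  exact lt_irrefl _ hy0

end TransferMatrix

/-! ### The parameterization of the robust controllers -/

theorem mainTheorem5 {p m : Type*} [Fintype p] [Fintype m] [DecidableEq p] [DecidableEq m]
    (T : TimeSetting) (G : TransferMatrix p m) (hG : G.IsProper) (ε : ℝ) (hε : 0 < ε) :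
    TransferMatrix.robustControllers T ε G =
        {K : TransferMatrix m p | ∃ (Y : TransferMatrix p p) (W : TransferMatrix p m)
            (U : TransferMatrix m p) (Z : TransferMatrix m m),
          TransferMatrix.IOPConstraints T G Y W U Z ∧
          U.hInfNorm T ≤ ENNReal.ofReal ε⁻¹ ∧
          IsUnit Y.det ∧ TransferMatrix.IsProper (U * Y⁻¹) ∧
          K = U * Y⁻¹} ∧
      (G.IsStrictlyProper →
        ∀ (Y : TransferMatrix p p) (W : TransferMatrix p m)
            (U : TransferMatrix m p) (Z : TransferMatrix m m),
          TransferMatrix.IOPConstraints T G Y W U Z →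
            IsUnit Y.det ∧ TransferMatrix.IsProper (U * Y⁻¹)) := by
  refine ⟨Set.ext fun K => ⟨?_, ?_⟩, fun hGs Y W U Z h => h.isUnit_det_and_isProper hGs⟩
  · rintro ⟨hKp, hK⟩
    have h0 := hK 0 (by
      refine lt_of_le_of_lt ((TransferMatrix.hInfNorm_le_ofReal_iff le_rfl).2 fun s _ => ?_)
        (ENNReal.ofReal_lt_ofReal_iff hε |>.2 hε)
      have h0 : TransferMatrix.evalAt (0 : TransferMatrix p m) s = 0 := by
        ext i j
        exact RatFunc.eval_zero _ _
      open scoped Matrix.Norms.L2Operator in rw [h0, norm_zero])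
    rw [add_zero] at h0
    obtain ⟨Y, W, U, Z, h, hUK, hY⟩ := h0.exists_parameters
    have hdet : IsUnit Y.det := Matrix.isUnit_det_of_left_inverse hY
    have hKeq : U * Y⁻¹ = K := by
      rw [hUK, Matrix.mul_assoc, Matrix.mul_nonsing_inv _ hdet, Matrix.mul_one]
    exact ⟨Y, W, U, Z, h, TransferMatrix.hInfNorm_le_of_internallyStabilizes hε hK
      (TransferMatrix.iopConstraints_iff.1 h).2.2.2.1 hUK hY, hdet, by rwa [hKeq], hKeq.symm⟩
  · rintro ⟨Y, W, U, Z, h, hU, hY, hp, rfl⟩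
    exact ⟨hp, fun Δ hΔ => h.internallyStabilizes_of_mem_uncertaintySet hY hε hU hΔ⟩
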